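/- Let $\mathbb S^3$ be the 6-dimensional space of complex symmetric $3\times 3$ matrices, where $M\in\mathbb S^3$ is identified with the conic $(x,y,z)\,M\,(x,y,z)^T$, and let $\mathbb P^5=\mathbb P(\mathbb S^3)$. A net of conics is a 3-dimensional linear subspace $\mathcal L\subset\mathbb S^3$. Two nets $\mathcal L_1,\mathcal L_2$ are congruent if $\mathcal L_2=g^T\mathcal L_1 g$ for some $g\in \mathrm{GL}_3(\mathbb C)$. A net $\mathcal L$ is of type $A$ if its discriminant, the cubic curve $\{\det=0\}\subset\mathbb P\mathcal L$, is smooth; of type $B^*$ if it is congruent to the span of $y^2+2xz,\ 2yz,\ -x^2-2y^2+2xz$; of type $D^*$ if it is congruent to the span of $2xz,\ 2yz,\ z^2+2xy$; and of type $E^*$ if it is congruent to the span of $2xz,\ 2yz,\ 2xy$. The reciprocal surface $\mathbb P\mathcal L^{-1}\subset\mathbb P^5$ is the Zariski closure of $\{[A^{-1}] : A\in\mathcal L,\ \det A\neq 0\}$. The Veronese surface in $\mathbb P^5$ is the image of $\mathbb P^2\to\mathbb P^5$, $(\alpha:\beta:\gamma)\mapsto [vv^T]$ with $v=(\alpha,\beta,\gamma)^T$.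 Theorem 3.2. For every net of conics $\mathcal L$ of type $A$, $B^*$, $D^*$ or $E^*$, the reciprocal surface $\mathbb P\mathcal L^{-1}$ is projectively equivalent to the Veronese surface, that is, some projective linear automorphism of $\mathbb P^5$ maps $\mathbb P\mathcal L^{-1}$ onto the Veronese surface. -/

import Mathlib

namespace NetsOfConics

open scoped LinearAlgebra.Projectivization

/-- The space of complex symmetric `3 × 3` matrices, i.e. of conics: `M` is identified with the
quadratic form `(x, y, z) M (x, y, z)ᵀ`. -/
def Sym3 : Submodule ℂ (Matrix (Fin 3) (Fin 3) ℂ) where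
  carrier := {M | M.IsSymm}
  add_mem' hM hN := hM.add hN
  zero_mem' := Matrix.isSymm_zero
  smul_mem' a _ hM := hM.smul a

/-- The projective space of symmetric matrices, which is `ℙ⁵`. -/
abbrev ProjSym3 : Type := ℙ ℂ Sym3

/-- The symmetric matrix of the conic `a x² + b y² + c z² + 2 d xy + 2 e xz + 2 f yz`. -/
def conic (a b c d e f : ℂ) : Sym3 :=
  ⟨!![a, d, e; d, b, f; e, f, c], by
    change Matrix.IsSymm _
    ext i j
    fin_cases i <;> fin_cases j <;> rfl⟩

/-! ### Zariski closure in `ℙ⁵` -/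

/-- The polynomial `f` in the matrix entries vanishes at (every representative of) the point `p`. -/
def VanishesAt (f : MvPolynomial (Fin 3 × Fin 3) ℂ) (p : ProjSym3) : Prop :=
  ∀ (M : Sym3) (hM : M ≠ 0), p = Projectivization.mk ℂ M hM →
    MvPolynomial.eval (fun ij : Fin 3 × Fin 3 => (M : Matrix (Fin 3) (Fin 3) ℂ) ij.1 ij.2) f = 0

/-- Zariski closed subsets of `ℙ⁵`: the common zero loci of sets of homogeneous polynomials. -/
def IsZariskiClosed (Z : Set ProjSym3) : Prop :=
  ∃ F : Set (MvPolynomial (Fin 3 × Fin 3) ℂ),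
    (∀ f ∈ F, ∃ d : ℕ, f.IsHomogeneous d) ∧ Z = {p | ∀ f ∈ F, VanishesAt f p}

/-- The Zariski closure: the intersection of all Zariski closed sets containing `X`. -/
def zariskiClosure (X : Set ProjSym3) : Set ProjSym3 :=
  ⋂₀ {Z | IsZariskiClosed Z ∧ X ⊆ Z}

/-! ### Reciprocal surface, Veronese surface, projective equivalence -/

/-- The set of points `[A⁻¹]`, where `A` runs over the invertible matrices in `L`. -/
def inverseLocus (L : Submodule ℂ Sym3) : Set ProjSym3 :=
  {p | ∃ A ∈ L, (A : Matrix (Fin 3) (Fin 3) ℂ).det ≠ 0 ∧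
    ∃ (B : Sym3) (hB : B ≠ 0),
      (B : Matrix (Fin 3) (Fin 3) ℂ) = (A : Matrix (Fin 3) (Fin 3) ℂ)⁻¹ ∧
      p = Projectivization.mk ℂ B hB}

/-- The reciprocal surface of `L`. -/
def reciprocalSurface (L : Submodule ℂ Sym3) : Set ProjSym3 :=
  zariskiClosure (inverseLocus L)

/-- The Veronese surface: the image of `(α : β : γ) ↦ (α, β, γ)ᵀ (α, β, γ)`. -/
def veroneseSurface : Set ProjSym3 :=
  {p | ∃ α β γ : ℂ, (α ≠ 0 ∨ β ≠ 0 ∨ γ ≠ 0) ∧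
    ∃ h : conic (α ^ 2) (β ^ 2) (γ ^ 2) (α * β) (α * γ) (β * γ) ≠ 0,
      p = Projectivization.mk ℂ (conic (α ^ 2) (β ^ 2) (γ ^ 2) (α * β) (α * γ) (β * γ)) h}

/-- Two subsets of `ℙ⁵` are projectively equivalent if a projective linear automorphism of `ℙ⁵`
maps the first onto the second. -/
def ProjectivelyEquivalent (X Y : Set ProjSym3) : Prop :=
  ∃ T : Sym3 ≃ₗ[ℂ] Sym3, Projectivization.map T.toLinearMap T.injective '' X = Y

/-! ### Nets of conics and their types -/

/-- A net of conics: a three-dimensional linear space of symmetric matrices. -/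
def IsNet (L : Submodule ℂ Sym3) : Prop := Module.finrank ℂ L = 3

/-- The discriminant of `L`, the zero locus in `ℙ(L)` of the cubic form `det`, is smooth: at no
point of it do all the directional derivatives of `det` along `L` vanish. -/
def SmoothDiscriminant (L : Submodule ℂ Sym3) : Prop :=
  ∀ A ∈ L, A ≠ 0 → (A : Matrix (Fin 3) (Fin 3) ℂ).det = 0 →
    ∃ B ∈ L, deriv (fun t : ℂ => ((A + t • B : Sym3) : Matrix (Fin 3) (Fin 3) ℂ).det) 0 ≠ 0

/-- `L₂ = gᵀ L₁ g` for some invertible matrix `g`. -/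
def Congruent (L₁ L₂ : Submodule ℂ Sym3) : Prop :=
  ∃ g : GL (Fin 3) ℂ, ∀ M : Sym3, M ∈ L₂ ↔ ∃ N ∈ L₁, (M : Matrix (Fin 3) (Fin 3) ℂ) =
    (g : Matrix (Fin 3) (Fin 3) ℂ).transpose * (N : Matrix (Fin 3) (Fin 3) ℂ) *
      (g : Matrix (Fin 3) (Fin 3) ℂ)

/-- Type `A`: nets with smooth discriminant cubic. -/
def IsTypeA (L : Submodule ℂ Sym3) : Prop := IsNet L ∧ SmoothDiscriminant L

/-- Type `B*`: the congruence class of the net spanned by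
`y² + 2xz`, `2yz`, `-x² - 2y² + 2xz`. -/
def IsTypeBStar (L : Submodule ℂ Sym3) : Prop :=
  Congruent (Submodule.span ℂ
    {conic 0 1 0 0 1 0, conic 0 0 0 0 0 1, conic (-1) (-2) 0 0 1 0}) L

/-- Type `D*`: the congruence class of the net spanned by `2xz`, `2yz`, `z² + 2xy`. -/
def IsTypeDStar (L : Submodule ℂ Sym3) : Prop :=
  Congruent (Submodule.span ℂ
    {conic 0 0 0 0 1 0, conic 0 0 0 0 0 1, conic 0 0 1 1 0 0}) L

/-- Type `E*`: the congruence class of the net spanned by `2xz`, `2yz`, `2xy`. -/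
def IsTypeEStar (L : Submodule ℂ Sym3) : Prop :=
  Congruent (Submodule.span ℂ
    {conic 0 0 0 0 1 0, conic 0 0 0 0 0 1, conic 0 0 0 1 0 0}) L

end NetsOfConics

namespace NetsOfConics

open Matrix

/-! On a net parametrized by `P`, the inverse of an invertible member is projectively its adjugate,
and the adjugate is quadratic in `x`. It therefore factors through `x ↦ x xᵀ` by a linear map
`adjMap`. If the adjugates span `Sym3`, that map is an automorphism and carries the Veronese surface
onto the reciprocal surface (`projectivelyEquivalent_of_adjugates_span`). The theorem thus reduces
to a spanning statement, which is a congruence invariant and a direct computation for the normal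
forms of `B*`, `D*`, `E*`.

For type `A`, suppose a linear form `φ` kills all adjugates. A singular member with kernel vector
`v` has adjugate `c v vᵀ`, and smoothness of the discriminant forces `c ≠ 0`, so the conic `v ↦ φ (v
vᵀ)` contains every such `v`. These `v` form the Jacobian cubic `det (kernelMatrix P v) = 0`, which
is again smooth (`kernelMatrix_smooth`). A smooth cubic lies on no conic
(`eq_zero_of_vanish_on_smooth_cubic`), hence `φ = 0`. -/

/-! ### Functions that are polynomial along lines -/

/-- A function on a complex vector space whose restriction to every line is a polynomial. -/
def PolyOnLines {V : Type*} [AddCommGroup V] [Module ℂ V] (φ : V → ℂ) : Prop :=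
  ∀ u w : V, ∃ P : Polynomial ℂ, ∀ t : ℂ, φ (u + t • w) = P.eval t

namespace PolyOnLines

variable {V : Type*} [AddCommGroup V] [Module ℂ V] {φ ψ : V → ℂ}

theorem const (c : ℂ) : PolyOnLines fun _ : V => c :=
  fun _ _ => ⟨Polynomial.C c, fun t => by simp⟩

theorem linear (l : V →ₗ[ℂ] ℂ) : PolyOnLines fun v => l v :=
  fun u w => ⟨Polynomial.C (l u) + Polynomial.X * Polynomial.C (l w), fun t => by simp; ring⟩

theorem add (hφ : PolyOnLines φ) (hψ : PolyOnLines ψ) : PolyOnLines fun v => φ v + ψ v := by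
  intro u w
  obtain ⟨P, hP⟩ := hφ u w
  obtain ⟨Q, hQ⟩ := hψ u w
  exact ⟨P + Q, fun t => by simp [hP, hQ]⟩

theorem mul (hφ : PolyOnLines φ) (hψ : PolyOnLines ψ) : PolyOnLines fun v => φ v * ψ v := by
  intro u w
  obtain ⟨P, hP⟩ := hφ u w
  obtain ⟨Q, hQ⟩ := hψ u w
  exact ⟨P * Q, fun t => by simp [hP, hQ]⟩

theorem sub (hφ : PolyOnLines φ) (hψ : PolyOnLines ψ) : PolyOnLines fun v => φ v - ψ v := by
  intro u w
  obtain ⟨P, hP⟩ := hφ u w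
  obtain ⟨Q, hQ⟩ := hψ u w
  exact ⟨P - Q, fun t => by simp [hP, hQ]⟩

theorem eval {σ : Type*} (f : MvPolynomial σ ℂ) {g : σ → V → ℂ} (hg : ∀ i, PolyOnLines (g i)) :
    PolyOnLines fun v => MvPolynomial.eval (fun i => g i v) f := by
  induction f using MvPolynomial.induction_on with
  | C a => simpa using const a
  | add p q hp hq => simpa using hp.add hq
  | mul_X p i hp => simpa using hp.mul (hg i)

theorem det {M : V → Matrix (Fin 3) (Fin 3) ℂ} (h : ∀ i j, PolyOnLines fun v => M v i j) :
    PolyOnLines fun v => (M v).det := by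
  simp only [Matrix.det_fin_three]
  exact ((((((((h 0 0).mul (h 1 1)).mul (h 2 2)).sub (((h 0 0).mul (h 1 2)).mul (h 2 1))).sub
    (((h 0 1).mul (h 1 0)).mul (h 2 2))).add (((h 0 1).mul (h 1 2)).mul (h 2 0))).add
    (((h 0 2).mul (h 1 0)).mul (h 2 1))).sub (((h 0 2).mul (h 1 1)).mul (h 2 0)))

theorem adjugate {M : V → Matrix (Fin 3) (Fin 3) ℂ} (h : ∀ i j, PolyOnLines fun v => M v i j)
    (i j : Fin 3) : PolyOnLines fun v => (M v).adjugate i j := by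
  have key : ∀ a b c d a' b' c' d' : Fin 3,
      PolyOnLines fun v => M v a b * M v c d - M v a' b' * M v c' d' := fun a b c d a' b' c' d' =>
    ((h a b).mul (h c d)).sub ((h a' b').mul (h c' d'))
  simp only [Matrix.adjugate_fin_three]
  fin_cases i <;> fin_cases j <;> simp [-neg_mul, neg_add_eq_sub] <;> apply key

/-- Functions that are polynomial on lines have no zero divisors. -/
theorem eq_zero_of_mul_eq_zero (hφ : PolyOnLines φ) (hψ : PolyOnLines ψ)
    (h : ∀ v, φ v * ψ v = 0) {w : V} (hw : ψ w ≠ 0) (u : V) : φ u = 0 := by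
  -- On the line through `u` (at `t = 0`) and `w` (at `t = 1`) the claim reduces to `ℂ[X]` being a
  -- domain.
  obtain ⟨P, hP⟩ := hφ u (w - u)
  obtain ⟨Q, hQ⟩ := hψ u (w - u)
  have hPQ : P * Q = 0 := Polynomial.funext fun t => by simp [← hP, ← hQ, h]
  rcases mul_eq_zero.1 hPQ with h0 | h0
  · simpa [h0] using hP 0
  · exact absurd (by simpa [h0] using hQ 1) hw

end PolyOnLines

/-! ### Determinants and adjugates along a pencil; quadratic equations -/

theorem trace_adjugate_mul (A B : Matrix (Fin 3) (Fin 3) ℂ) : (A.adjugate * B).trace =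
    (A 1 1 * A 2 2 - A 1 2 * A 2 1) * B 0 0 + (A 0 2 * A 2 1 - A 0 1 * A 2 2) * B 1 0 +
    (A 0 1 * A 1 2 - A 0 2 * A 1 1) * B 2 0 + (A 1 2 * A 2 0 - A 1 0 * A 2 2) * B 0 1 +
    (A 0 0 * A 2 2 - A 0 2 * A 2 0) * B 1 1 + (A 0 2 * A 1 0 - A 0 0 * A 1 2) * B 2 1 +
    (A 1 0 * A 2 1 - A 1 1 * A 2 0) * B 0 2 + (A 0 1 * A 2 0 - A 0 0 * A 2 1) * B 1 2 +
    (A 0 0 * A 1 1 - A 0 1 * A 1 0) * B 2 2 := by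
  rw [Matrix.trace_fin_three]
  simp only [Matrix.mul_apply, Fin.sum_univ_three, Matrix.adjugate_fin_three]
  simp
  ring

/-- Expansion of the determinant of a pencil of `3 × 3` matrices. -/
theorem det_add_smul (A B : Matrix (Fin 3) (Fin 3) ℂ) (t : ℂ) :
    (A + t • B).det = A.det + t * (A.adjugate * B).trace + t ^ 2 * (B.adjugate * A).trace +
      t ^ 3 * B.det := by
  simp [Matrix.det_fin_three, trace_adjugate_mul]
  ring

theorem deriv_det_add_smul (A B : Matrix (Fin 3) (Fin 3) ℂ) :
    deriv (fun t : ℂ => (A + t • B).det) 0 = (A.adjugate * B).trace := by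
  have h : (fun t : ℂ => (A + t • B).det) = fun t : ℂ => (Polynomial.C A.det +
      Polynomial.X * Polynomial.C (A.adjugate * B).trace +
      Polynomial.X ^ 2 * Polynomial.C (B.adjugate * A).trace +
      Polynomial.X ^ 3 * Polynomial.C B.det).eval t := by
    funext t
    simp [det_add_smul]
    ring
  rw [h, Polynomial.deriv]
  simp

theorem adjugate_add_smul (A B : Matrix (Fin 3) (Fin 3) ℂ) (t : ℂ) :
    (A + t • B).adjugate = A.adjugate + t • ((A + B).adjugate - A.adjugate - B.adjugate) +
      t ^ 2 • B.adjugate := by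
  ext i j
  simp only [Matrix.adjugate_fin_three]
  fin_cases i <;> fin_cases j <;> simp <;> ring

/-- Completing the square: `4a(as² + bs + c) = (2as + b)² - d²`. Both signs of `d` are kept because
the two roots will be compared with each other. -/
theorem exists_quadratic_discriminant {a : ℂ} (b c : ℂ) (ha : a ≠ 0) :
    ∃ d : ℂ, d ^ 2 = b ^ 2 - 4 * a * c ∧
      ∀ s : ℂ, (2 * a * s + b = d ∨ 2 * a * s + b = -d) → a * s ^ 2 + b * s + c = 0 := by
  obtain ⟨d, hd⟩ := IsAlgClosed.exists_pow_nat_eq (b ^ 2 - 4 * a * c) (n := 2) (by norm_num)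
  refine ⟨d, hd, fun s hs => ?_⟩
  have h : 4 * a * (a * s ^ 2 + b * s + c) = 0 := by
    rcases hs with hs | hs
    · linear_combination (2 * a * s + b + d) * hs + hd
    · linear_combination (2 * a * s + b - d) * hs + hd
  exact (mul_eq_zero.1 h).resolve_left (mul_ne_zero (by norm_num) ha)

theorem exists_quadratic_root {a : ℂ} (b c : ℂ) (ha : a ≠ 0) :
    ∃ s : ℂ, a * s ^ 2 + b * s + c = 0 := by
  obtain ⟨d, -, h⟩ := exists_quadratic_discriminant b c ha
  exact ⟨(d - b) / (2 * a), h _ (Or.inl (by field_simp; ring))⟩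

/-- Two linear forms on `ℂ³` have a common nontrivial zero. -/
theorem exists_common_zero (a b : (Fin 3 → ℂ) →ₗ[ℂ] ℂ) : ∃ w ≠ 0, a w = 0 ∧ b w = 0 := by
  obtain ⟨w, hw, hw0⟩ := Submodule.exists_mem_ne_zero_of_ne_bot
    (LinearMap.ker_ne_bot_of_finrank_lt (f := a.prod b) (by simp))
  exact ⟨w, hw0, by simpa using hw⟩

/-- The lower coefficients of a cubic polynomial with vanishing values are zero. -/
theorem coeffs_eq_zero_of_cubic {c₀ c₁ c₂ c₃ : ℂ}
    (h : ∀ t : ℂ, t ≠ 0 → c₀ + t * c₁ + t ^ 2 * c₂ + t ^ 3 * c₃ = 0) : c₀ = 0 ∧ c₁ = 0 := by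
  have h1 := h 1 (by norm_num)
  have h2 := h (-1) (by norm_num)
  have h3 := h 2 (by norm_num)
  have h4 := h (-2) (by norm_num)
  constructor
  · linear_combination (2 / 3) * (h1 + h2) - (1 / 6) * (h3 + h4)
  · linear_combination (2 / 3) * (h1 - h2) - (1 / 12) * (h3 - h4)

/-! ### Smooth cubics and conics -/

/-- A smooth plane cubic, given by a determinantal representation, lies on no conic. -/
theorem eq_zero_of_vanish_on_smooth_cubic
    (N : (Fin 3 → ℂ) →ₗ[ℂ] Matrix (Fin 3) (Fin 3) ℂ)
    (hN : ∀ v ≠ 0, (N v).det = 0 → ∃ w, ((N v).adjugate * N w).trace ≠ 0)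
    (β : (Fin 3 → ℂ) →ₗ[ℂ] (Fin 3 → ℂ) →ₗ[ℂ] ℂ)
    (hβ : ∀ v ≠ 0, (N v).det = 0 → β v v = 0) (v : Fin 3 → ℂ) : β v v = 0 := by
  by_contra hv
  have hNlin : ∀ i j, PolyOnLines fun v => N v i j := fun i j =>
    PolyOnLines.linear ((LinearMap.proj j).comp ((LinearMap.proj i).comp N))
  have expand : ∀ (s : ℂ) (x y : Fin 3 → ℂ), (N (x + s • y)).det = (N x).det +
      s * ((N x).adjugate * N y).trace + s ^ 2 * ((N y).adjugate * N x).trace +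
      s ^ 3 * (N y).det := fun s x y => by rw [map_add, map_smul, det_add_smul]
  -- a point of the cubic
  obtain ⟨p, hp, hpN⟩ : ∃ p ≠ 0, (N p).det = 0 := by
    -- If the second basis vector is not on the cubic, `det N` has degree exactly three in `s` along
    -- `x + s • y`, hence a root.
    by_cases h : (N (Pi.single 1 1)).det = 0
    · exact ⟨_, by simp, h⟩
    set x : Fin 3 → ℂ := Pi.single 0 1
    set y : Fin 3 → ℂ := Pi.single 1 1
    obtain ⟨s, hs⟩ := IsAlgClosed.exists_root
      (p := Polynomial.C (N y).det * Polynomial.X ^ 3 +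
        Polynomial.C ((N y).adjugate * N x).trace * Polynomial.X ^ 2 +
        Polynomial.C ((N x).adjugate * N y).trace * Polynomial.X + Polynomial.C (N x).det)
      (by rw [Polynomial.degree_cubic h]; norm_num)
    refine ⟨x + s • y, fun h0 => ?_, ?_⟩
    · simpa [x, y] using congrFun h0 0
    · rw [expand]
      simp at hs
      linear_combination hs
  obtain ⟨u', hu'⟩ := hN p hp hpN
  let a : (Fin 3 → ℂ) →ₗ[ℂ] ℂ :=
    (Matrix.traceLinearMap (Fin 3) ℂ ℂ).comp ((LinearMap.mulLeft ℂ (N p).adjugate).comp N)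
  have ha : ∀ w, a w = ((N p).adjugate * N w).trace := fun w => rfl
  have hap : a p = 0 := by rw [ha, Matrix.adjugate_mul, hpN]; simp
  obtain ⟨u, hu⟩ : ∃ u, a u = 1 := ⟨(a u')⁻¹ • u', by
    rw [map_smul, smul_eq_mul]; exact inv_mul_cancel₀ hu'⟩
  set b : (Fin 3 → ℂ) → ℂ := fun w => ((N w).adjugate * N p).trace with hb
  have hbpoly : PolyOnLines b := by
    simp only [hb, Matrix.trace_fin_three, Matrix.mul_apply, Fin.sum_univ_three]
    have h : ∀ i j k l : Fin 3, PolyOnLines fun w => (N w).adjugate i j * N p k l :=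
      fun i j k l => (PolyOnLines.adjugate hNlin i j).mul (PolyOnLines.const _)
    exact ((((h _ _ _ _).add (h _ _ _ _)).add (h _ _ _ _)).add
      (((h _ _ _ _).add (h _ _ _ _)).add (h _ _ _ _))).add
      (((h _ _ _ _).add (h _ _ _ _)).add (h _ _ _ _))
  have hβpoly : PolyOnLines fun w => β w w := fun x y =>
    ⟨Polynomial.C (β x x) + Polynomial.X * Polynomial.C (β x y + β y x) +
      Polynomial.X ^ 2 * Polynomial.C (β y y), fun t => by simp; ring⟩
  -- the discriminant of the residual pair of points on a line through `p`
  have disc0 : ∀ w, ((b w) ^ 2 - 4 * a w * (N w).det) * (a w * β w w) = 0 := by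
    intro w
    by_cases haw : a w = 0
    · rw [haw]; ring
    obtain ⟨d, hd, hroot⟩ := exists_quadratic_discriminant (b w) (N w).det haw
    -- The conic passes through `p`, so its equation at `w + s • p` is affine in `s`; it vanishes at
    -- both residual intersections of the line with the cubic.
    have hon : ∀ s : ℂ, (2 * a w * s + b w = d ∨ 2 * a w * s + b w = -d) →
        s * (β w p + β p w) + β w w = 0 := by
      intro s hs
      have h0 : w + s • p ≠ 0 := fun h0 => haw (by
        have := congrArg a h0
        simpa [hap] using this)
      have h1 : (N (w + s • p)).det = 0 := by
        rw [expand, hpN, ← ha w]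
        have := hroot s hs
        simp only [hb] at this
        linear_combination this
      have h2 := hβ _ h0 h1
      have h3 := hβ p hp hpN
      simp at h2
      linear_combination h2 - s ^ 2 * h3
    have h1 := hon ((d - b w) / (2 * a w)) (Or.inl (by field_simp; ring))
    have h2 := hon ((-d - b w) / (2 * a w)) (Or.inr (by field_simp; ring))
    field_simp at h1 h2
    rw [← hd]
    -- The combination eliminates the polar term and leaves `d² · a w · β w w`.
    linear_combination (d / 4) * ((d + b w) * h1 + (d - b w) * h2)
  have disc : ∀ w, (b w) ^ 2 = 4 * a w * (N w).det := by
    intro w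
    have hdp : PolyOnLines fun w => (b w) ^ 2 - 4 * a w * (N w).det := by
      simp only [pow_two]
      exact (hbpoly.mul hbpoly).sub
        (((PolyOnLines.const 4).mul (PolyOnLines.linear a)).mul (PolyOnLines.det hNlin))
    -- Both factors `β w w` and `a w` are cancelled, being nonzero at `v` and at `u` respectively.
    have h1 := hdp.eq_zero_of_mul_eq_zero (PolyOnLines.linear a) (w := u)
      (fun x => by
        refine PolyOnLines.eq_zero_of_mul_eq_zero (hdp.mul (PolyOnLines.linear a)) hβpoly
          (fun y => ?_) hv x
        linear_combination disc0 y) (by simp [hu]) w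
    linear_combination h1
  -- the polar of `b` with respect to `u`
  let b₁ : (Fin 3 → ℂ) →ₗ[ℂ] ℂ :=
    { toFun := fun w => (((N (w + u)).adjugate - (N w).adjugate - (N u).adjugate) * N p).trace
      map_add' := fun x y => by
        simp only [map_add]
        simp only [Matrix.sub_mul, Matrix.trace_sub, trace_adjugate_mul]
        simp
        ring
      map_smul' := fun c x => by
        simp only [map_add, map_smul]
        simp only [Matrix.sub_mul, Matrix.trace_sub, trace_adjugate_mul]
        simp
        ring }
  have hb₁ : ∀ w (t : ℂ), b (w + t • u) = b w + t * b₁ w + t ^ 2 * b u := by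
    intro w t
    change _ = _ + t * (((N (w + u)).adjugate - (N w).adjugate - (N u).adjugate) * N p).trace + _
    simp only [hb, map_add, map_smul, adjugate_add_smul, Matrix.add_mul, Matrix.smul_mul,
      Matrix.trace_add, Matrix.trace_smul, smul_eq_mul]
  -- This point of the tangent line `a = 0` will turn out to be singular on the cubic.
  obtain ⟨w, hw0, haw, hbw⟩ := exists_common_zero a b₁
  -- Along `x + t • u` the form `a` equals `t`. Dividing `b² = 4 a det N` by `t` and comparing the
  -- two lowest coefficients gives both claims; in particular the whole line `a = 0` lies on the
  -- cubic.
  have hker : ∀ x, a x = 0 → (N x).det = 0 ∧ 4 * ((N x).adjugate * N u).trace = b₁ x ^ 2 := by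
    intro x hx
    have hbx : b x = 0 := by
      have := disc x
      rw [hx] at this
      exact pow_eq_zero_iff (n := 2) (by norm_num) |>.1 (by linear_combination this)
    have := coeffs_eq_zero_of_cubic (c₀ := 4 * (N x).det)
      (c₁ := 4 * ((N x).adjugate * N u).trace - b₁ x ^ 2)
      (c₂ := 4 * ((N u).adjugate * N x).trace - 2 * b₁ x * b u)
      (c₃ := 4 * (N u).det - b u ^ 2) (fun t ht => by
        have h := disc (x + t • u)
        rw [hb₁, expand, map_add, map_smul, hx, hu, hbx] at h
        simp only [smul_eq_mul] at h
        apply mul_left_cancel₀ ht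
        linear_combination -h)
    exact ⟨by linear_combination this.1 / 4, by linear_combination this.2⟩
  obtain ⟨hJw, hwu⟩ := hker w haw
  obtain ⟨y, hy⟩ := hN w hw0 hJw
  apply hy
  -- Split `y` into a part in `ker a` and a multiple of `u`. The derivative at `w` vanishes on the
  -- first since `det N` vanishes on `ker a`, and on `u` since `b₁ w = 0`.
  have hwk : ((N w).adjugate * N (y - a y • u)).trace = 0 := by
    have hk : a (y - a y • u) = 0 := by simp [hu]
    refine (coeffs_eq_zero_of_cubic (c₀ := (N w).det)
      (c₂ := ((N (y - a y • u)).adjugate * N w).trace)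
      (c₃ := (N (y - a y • u)).det) fun t _ => ?_).2
    rw [← expand]
    exact (hker _ (by simp only [map_add, map_smul, haw, hk]; simp)).1
  rw [hbw] at hwu
  rw [map_sub, map_smul, Matrix.mul_sub, Matrix.trace_sub, Matrix.mul_smul, Matrix.trace_smul,
    smul_eq_mul] at hwk
  linear_combination hwk + a y / 4 * hwu

/-! ### Rank one matrices and linearization of the adjugate -/

theorem sym3_apply_comm (S : Sym3) (i j : Fin 3) : S.1 i j = S.1 j i :=
  (congrFun (congrFun S.2 i) j).symm

theorem sym3_eq_conic (S : Sym3) :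
    S = conic (S.1 0 0) (S.1 1 1) (S.1 2 2) (S.1 0 1) (S.1 0 2) (S.1 1 2) := by
  apply Subtype.ext
  ext i j
  fin_cases i <;> fin_cases j <;> simp [conic] <;>
    exact sym3_apply_comm S _ _

/-- The adjugate of a symmetric matrix. -/
def adjSym (S : Sym3) : Sym3 :=
  ⟨S.1.adjugate, by
    change S.1.adjugate.transpose = _
    rw [Matrix.adjugate_transpose]
    exact congrArg _ S.2⟩

/-- The symmetric rank one matrix `v vᵀ`. -/
def veronese (v : Fin 3 → ℂ) : Sym3 :=
  conic (v 0 ^ 2) (v 1 ^ 2) (v 2 ^ 2) (v 0 * v 1) (v 0 * v 2) (v 1 * v 2)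

theorem veronese_apply (v : Fin 3 → ℂ) (i j : Fin 3) : (veronese v).1 i j = v i * v j := by
  fin_cases i <;> fin_cases j <;> simp [veronese, conic] <;> ring

theorem veronese_ne_zero {v : Fin 3 → ℂ} (hv : v ≠ 0) : veronese v ≠ 0 := by
  intro h
  apply hv
  ext i
  have := veronese_apply v i i
  rw [h] at this
  simpa using this.symm

theorem mem_veroneseSurface {p : ProjSym3} :
    p ∈ veroneseSurface ↔ ∃ v : Fin 3 → ℂ, ∃ hv : v ≠ 0,
      p = Projectivization.mk ℂ (veronese v) (veronese_ne_zero hv) := by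
  constructor
  · rintro ⟨α, β, γ, h, h', rfl⟩
    refine ⟨![α, β, γ], fun h0 => ?_, rfl⟩
    have h0' := congrFun h0 0
    have h1' := congrFun h0 1
    have h2' := congrFun h0 2
    simp at h0' h1' h2'
    tauto
  · rintro ⟨v, hv, rfl⟩
    refine ⟨v 0, v 1, v 2, ?_, veronese_ne_zero hv, rfl⟩
    by_contra! h
    apply hv
    ext i
    fin_cases i
    exacts [h.1, h.2.1, h.2.2]

/-- A symmetric matrix all of whose `2 × 2` minors vanish is of the form `v vᵀ`. -/
theorem exists_veronese_eq (S : Sym3)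
    (hS : ∀ i j k l, S.1 i j * S.1 k l - S.1 i l * S.1 k j = 0) : ∃ v, S = veronese v := by
  by_cases hdiag : ∀ i, S.1 i i = 0
  · refine ⟨0, Subtype.ext ?_⟩
    ext i j
    have h := hS i j j i
    rw [sym3_apply_comm S j i, hdiag i] at h
    rw [veronese_apply]
    simpa using h
  · push Not at hdiag
    obtain ⟨k, hk⟩ := hdiag
    obtain ⟨d, hd⟩ := IsAlgClosed.exists_pow_nat_eq (S.1 k k) (n := 2) (by norm_num)
    have hd0 : d ≠ 0 := by
      rintro rfl
      exact hk (by rw [← hd]; norm_num)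
    -- If `S = v vᵀ`, row `k` is `v k • v`, and `v k` is a square root of the diagonal entry.
    refine ⟨fun i => S.1 k i / d, Subtype.ext ?_⟩
    ext i j
    rw [veronese_apply]
    field_simp
    rw [hd]
    have h := hS i j k k
    rw [sym3_apply_comm S i k] at h
    linear_combination h

/-- The linear map on symmetric matrices taking `x xᵀ` to the adjugate of
`x 0 • A + x 1 • B + x 2 • C`. -/
def adjMap (A B C : Sym3) : Sym3 →ₗ[ℂ] Sym3 where
  toFun S := S.1 0 0 • adjSym A + S.1 1 1 • adjSym B + S.1 2 2 • adjSym C +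
    S.1 0 1 • (adjSym (A + B) - adjSym A - adjSym B) +
    S.1 0 2 • (adjSym (A + C) - adjSym A - adjSym C) +
    S.1 1 2 • (adjSym (B + C) - adjSym B - adjSym C)
  map_add' S S' := by
    simp only [Submodule.coe_add, Matrix.add_apply]
    module
  map_smul' c S := by
    simp only [Submodule.coe_smul, Matrix.smul_apply, smul_eq_mul, RingHom.id_apply]
    module

/-- The adjugate is quadratic, hence linear in the degree two monomials of `x`, which are the
entries of `veronese x`. -/
theorem adjMap_veronese (A B C : Sym3) (x : Fin 3 → ℂ) :
    adjMap A B C (veronese x) = adjSym (x 0 • A + x 1 • B + x 2 • C) := by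
  apply Subtype.ext
  simp only [adjMap, LinearMap.coe_mk, AddHom.coe_mk, veronese_apply, adjSym, Submodule.coe_add,
    Submodule.coe_smul, Submodule.coe_sub]
  ext i j
  simp only [Matrix.adjugate_fin_three]
  fin_cases i <;> fin_cases j <;> simp <;> ring

/-! ### Zariski closedness of linear images of the Veronese surface -/

/-- The coordinate form on matrices which agrees on symmetric ones with a given linear form. -/
noncomputable def linearFormPoly (l : Sym3 →ₗ[ℂ] ℂ) : MvPolynomial (Fin 3 × Fin 3) ℂ :=
  MvPolynomial.C (l (conic 1 0 0 0 0 0)) * MvPolynomial.X (0, 0) +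
  MvPolynomial.C (l (conic 0 1 0 0 0 0)) * MvPolynomial.X (1, 1) +
  MvPolynomial.C (l (conic 0 0 1 0 0 0)) * MvPolynomial.X (2, 2) +
  MvPolynomial.C (l (conic 0 0 0 1 0 0)) * MvPolynomial.X (0, 1) +
  MvPolynomial.C (l (conic 0 0 0 0 1 0)) * MvPolynomial.X (0, 2) +
  MvPolynomial.C (l (conic 0 0 0 0 0 1)) * MvPolynomial.X (1, 2)

theorem conic_eq_sum (a b c d e f : ℂ) : conic a b c d e f =
    a • conic 1 0 0 0 0 0 + b • conic 0 1 0 0 0 0 + c • conic 0 0 1 0 0 0 +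
    d • conic 0 0 0 1 0 0 + e • conic 0 0 0 0 1 0 + f • conic 0 0 0 0 0 1 := by
  apply Subtype.ext
  ext i j
  fin_cases i <;> fin_cases j <;> simp [conic]

theorem linearFormPoly_isHomogeneous (l : Sym3 →ₗ[ℂ] ℂ) : (linearFormPoly l).IsHomogeneous 1 := by
  have h : ∀ (c : ℂ) (i : Fin 3 × Fin 3),
      (MvPolynomial.C c * MvPolynomial.X i : MvPolynomial _ ℂ).IsHomogeneous 1 := fun c i => by
    simpa using (MvPolynomial.isHomogeneous_C _ c).mul (MvPolynomial.isHomogeneous_X ℂ i)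
  exact (((((h _ _).add (h _ _)).add (h _ _)).add (h _ _)).add (h _ _)).add (h _ _)

theorem eval_linearFormPoly (l : Sym3 →ₗ[ℂ] ℂ) (S : Sym3) :
    MvPolynomial.eval (fun ij : Fin 3 × Fin 3 => S.1 ij.1 ij.2) (linearFormPoly l) = l S := by
  conv_rhs => rw [sym3_eq_conic S, conic_eq_sum]
  simp [linearFormPoly]
  ring

theorem eval_smul_of_isHomogeneous {σ : Type*} {f : MvPolynomial σ ℂ} {d : ℕ}
    (hf : f.IsHomogeneous d) (c : ℂ) (x : σ → ℂ) :
    MvPolynomial.eval (c • x) f = c ^ d * MvPolynomial.eval x f := by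
  rw [MvPolynomial.eval_eq, MvPolynomial.eval_eq, Finset.mul_sum]
  refine Finset.sum_congr rfl fun m hm => ?_
  have hdeg : ∑ i ∈ m.support, m i = d := by
    have := hf (MvPolynomial.mem_support_iff.1 hm)
    simpa [Finsupp.weight_apply, Finsupp.sum] using this
  simp only [Pi.smul_apply, smul_eq_mul, mul_pow, Finset.prod_mul_distrib,
    Finset.prod_pow_eq_pow_sum, hdeg]
  ring

/-- The image of the Veronese surface under a projective automorphism is Zariski closed. -/
theorem isZariskiClosed_image_veroneseSurface (T : Sym3 ≃ₗ[ℂ] Sym3) :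
    IsZariskiClosed (Projectivization.map T.toLinearMap T.injective '' veroneseSurface) := by
  let l : Fin 3 → Fin 3 → Sym3 →ₗ[ℂ] ℂ := fun i j =>
    (((LinearMap.proj j).comp (LinearMap.proj i)).comp Sym3.subtype).comp T.symm.toLinearMap
  have hl : ∀ i j S, l i j S = (T.symm S).1 i j := fun _ _ _ => rfl
  -- The equations are the `2 × 2` minors of `T⁻¹ M`, written as quadrics in the entries of `M`.
  refine ⟨{f | ∃ i j k m, f = linearFormPoly (l i j) * linearFormPoly (l k m) -
    linearFormPoly (l i m) * linearFormPoly (l k j)}, ?_, ?_⟩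
  · rintro f ⟨i, j, k, m, rfl⟩
    have h := fun i j => linearFormPoly_isHomogeneous (l i j)
    exact ⟨1 + 1, ((h i j).mul (h k m)).sub ((h i m).mul (h k j))⟩
  · ext p
    constructor
    · rintro ⟨q, hq, rfl⟩ f ⟨i, j, k, m, rfl⟩ M hM hp
      obtain ⟨v, hv, rfl⟩ := mem_veroneseSurface.1 hq
      rw [Projectivization.map_mk, Projectivization.mk_eq_mk_iff'] at hp
      obtain ⟨c, hc⟩ := hp
      have hc0 : c ≠ 0 := by
        rintro rfl
        rw [zero_smul] at hc
        exact veronese_ne_zero hv (T.map_eq_zero_iff.1 hc.symm)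
      have hM' : M = T (c⁻¹ • veronese v) := by
        rw [map_smul]
        change c • M = T (veronese v) at hc
        rw [← hc, inv_smul_smul₀ hc0]
      simp only [map_sub, map_mul, eval_linearFormPoly, hl, hM', LinearEquiv.symm_apply_apply,
        Submodule.coe_smul, Matrix.smul_apply, veronese_apply, smul_eq_mul]
      ring
    · intro hp
      induction p using Projectivization.ind with
      | h M hM =>
        obtain ⟨v, hv⟩ := exists_veronese_eq (T.symm M) fun i j k m => by
          have := hp _ ⟨i, j, k, m, rfl⟩ M hM rfl
          simpa only [map_sub, map_mul, eval_linearFormPoly, hl] using this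
        have hMv : M = T (veronese v) := by rw [← hv, LinearEquiv.apply_symm_apply]
        have hv0 : v ≠ 0 := by
          rintro rfl
          apply hM
          rw [hMv, T.map_eq_zero_iff]
          apply Subtype.ext
          ext i j
          simp [veronese_apply]
        refine ⟨_, mem_veroneseSurface.2 ⟨v, hv0, rfl⟩, ?_⟩
        rw [Projectivization.map_mk]
        congr 1
        exact hMv.symm

/-! ### The spanning criterion -/

theorem IsNet.exists_parametrization {L : Submodule ℂ Sym3} (hL : IsNet L) :
    ∃ P : (Fin 3 → ℂ) →ₗ[ℂ] Sym3, Function.Injective P ∧ (∀ x, P x ∈ L) ∧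
      ∀ A ∈ L, ∃ x, P x = A := by
  have : Module.Free ℂ L := Module.Free.of_divisionRing ℂ ↥L
  have : Module.Finite ℂ L := Module.finite_of_finrank_pos (by rw [hL]; norm_num)
  let e : (Fin 3 → ℂ) ≃ₗ[ℂ] L := LinearEquiv.ofFinrankEq _ _ (by rw [hL]; simp)
  exact ⟨L.subtype.comp e.toLinearMap, L.injective_subtype.comp e.injective, fun x => (e x).2,
    fun A hA => ⟨e.symm ⟨A, hA⟩, by simp⟩⟩

/-- If the adjugates of the elements of a net span all symmetric matrices, and the net contains an
invertible matrix, then its reciprocal surface is a projectively transformed Veronese surface. -/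
theorem projectivelyEquivalent_of_adjugates_span {L : Submodule ℂ Sym3} (hL : IsNet L)
    (hdet : ∃ A ∈ L, A.1.det ≠ 0)
    (hspan : ∀ φ : Sym3 →ₗ[ℂ] ℂ, (∀ A ∈ L, φ (adjSym A) = 0) → φ = 0) :
    ProjectivelyEquivalent (reciprocalSurface L) veroneseSurface := by
  obtain ⟨P, -, hPL, hLP⟩ := hL.exists_parametrization
  let A := P (Pi.single 0 1)
  let B := P (Pi.single 1 1)
  let C := P (Pi.single 2 1)
  have hP : ∀ x, P x = x 0 • A + x 1 • B + x 2 • C := fun x => by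
    simp only [A, B, C, ← map_smul, ← map_add]
    congr 1
    ext i
    fin_cases i <;> simp
  have hadj : ∀ x, adjMap A B C (veronese x) = adjSym (P x) := fun x => by
    rw [adjMap_veronese, hP]
  have hsurj : Function.Surjective (adjMap A B C) := by
    rw [← LinearMap.range_eq_top]
    by_contra hne
    -- A proper range would lie in the kernel of a nonzero form, which then kills every adjugate.
    obtain ⟨φ, hφ, hle⟩ := Submodule.exists_le_ker_of_lt_top _ (lt_top_iff_ne_top.2 hne)
    refine hφ (hspan φ fun A' hA' => ?_)
    obtain ⟨x, rfl⟩ := hLP A' hA'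
    exact hle ⟨veronese x, hadj x⟩
  let T : Sym3 ≃ₗ[ℂ] Sym3 := LinearEquiv.ofBijective (adjMap A B C)
    ⟨LinearMap.injective_iff_surjective.2 hsurj, hsurj⟩
  have hT : ∀ x, T (veronese x) = adjSym (P x) := hadj
  have hadj0 : ∀ x ≠ 0, adjSym (P x) ≠ 0 := fun x hx => by
    rw [← hT]
    exact fun h => veronese_ne_zero hx (T.map_eq_zero_iff.1 h)
  -- a point of the inverse locus is the class of the adjugate
  have hinv : ∀ (x : Fin 3 → ℂ) (hx : x ≠ 0), (P x).1.det ≠ 0 →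
      Projectivization.mk ℂ (adjSym (P x)) (hadj0 x hx) ∈ inverseLocus L := by
    intro x hx hd
    refine ⟨P x, hPL x, hd, ((P x).1.det)⁻¹ • adjSym (P x),
      smul_ne_zero (inv_ne_zero hd) (hadj0 x hx), ?_, ?_⟩
    · simp [Matrix.inv_def, adjSym]
    · rw [Projectivization.mk_eq_mk_iff']
      exact ⟨(P x).1.det, smul_inv_smul₀ hd _⟩
  have hkey : reciprocalSurface L =
      Projectivization.map T.toLinearMap T.injective '' veroneseSurface := by
    apply Set.Subset.antisymm
    · refine Set.sInter_subset_of_mem ⟨isZariskiClosed_image_veroneseSurface T, ?_⟩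
      rintro p ⟨A', hA', hd, S, hS, hSA, rfl⟩
      obtain ⟨x, rfl⟩ := hLP A' hA'
      have hx : x ≠ 0 := by
        rintro rfl
        simp at hd
      refine ⟨_, mem_veroneseSurface.2 ⟨x, hx, rfl⟩, ?_⟩
      rw [Projectivization.map_mk, Projectivization.mk_eq_mk_iff']
      refine ⟨(P x).1.det, ?_⟩
      change _ = T (veronese x)
      rw [hT]
      apply Subtype.ext
      simp [hSA, Matrix.inv_def, adjSym, hd]
    · rintro p ⟨q, hq, rfl⟩ Z ⟨⟨F, hF, rfl⟩, hZ⟩ f hf M hM hp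
      obtain ⟨x, hx, rfl⟩ := mem_veroneseSurface.1 hq
      rw [Projectivization.map_mk, Projectivization.mk_eq_mk_iff'] at hp
      obtain ⟨c, hc⟩ := hp
      change c • M = T (veronese x) at hc
      rw [hT] at hc
      have hc0 : c ≠ 0 := by
        rintro rfl
        rw [zero_smul] at hc
        exact hadj0 x hx hc.symm
      obtain ⟨d, hd⟩ := hF f hf
      obtain ⟨A₀, hA₀, hA₀d⟩ := hdet
      obtain ⟨x₀, rfl⟩ := hLP A₀ hA₀
      have hPpoly : ∀ i j, PolyOnLines fun y => (P y).1 i j := fun i j =>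
        PolyOnLines.linear (((LinearMap.proj j).comp (LinearMap.proj i)).comp
          (Sym3.subtype.comp P))
      -- The product `f (adj (P y)) · det (P y)` vanishes for all `y`, and `det` is not identically
      -- zero on the net, so `f` also vanishes at adjugates of singular members.
      have hx0 := (PolyOnLines.eval f (g := fun ij y => (P y).1.adjugate ij.1 ij.2)
        (fun ij => PolyOnLines.adjugate hPpoly ij.1 ij.2)).eq_zero_of_mul_eq_zero
        (PolyOnLines.det hPpoly) (fun y => by
          by_cases hy : (P y).1.det = 0
          · rw [hy, mul_zero]
          · have hy0 : y ≠ 0 := by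
              rintro rfl
              simp at hy
            have := hZ (hinv y hy0 hy) f hf _ (hadj0 y hy0) rfl
            simp only [adjSym] at this
            rw [this, zero_mul]) hA₀d x
      have hMeq : (fun ij : Fin 3 × Fin 3 => M.1 ij.1 ij.2) =
          c⁻¹ • fun ij : Fin 3 × Fin 3 => (P x).1.adjugate ij.1 ij.2 := by
        have : M = c⁻¹ • adjSym (P x) := by rw [← hc, inv_smul_smul₀ hc0]
        rw [this]
        rfl
      rw [hMeq, eval_smul_of_isHomogeneous hd, hx0, mul_zero]
  refine ⟨T.symm, ?_⟩
  rw [hkey, Set.image_image]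
  convert Set.image_id veroneseSurface using 1
  refine Set.image_congr fun p _ => ?_
  induction p using Projectivization.ind with
  | h v hv =>
    rw [Projectivization.map_mk, Projectivization.map_mk]
    simp


/-! ### The Jacobian cubic of a net -/

/-- For `v ≠ 0`, the columns of the adjugate lie in the kernel, which is the line of `v` in rank
two; in lower rank the adjugate is zero. -/
theorem mul_adjugate_comm_of_mulVec_eq_zero {A : Matrix (Fin 3) (Fin 3) ℂ} {v : Fin 3 → ℂ}
    (h : A *ᵥ v = 0) (i j k : Fin 3) : v i * A.adjugate j k = v j * A.adjugate i k := by
  have h0 := congrFun h 0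
  have h1 := congrFun h 1
  have h2 := congrFun h 2
  simp only [Matrix.mulVec, dotProduct, Fin.sum_univ_three, Pi.zero_apply] at h0 h1 h2
  simp only [Matrix.adjugate_fin_three]
  fin_cases i <;> fin_cases j <;> fin_cases k <;> simp <;> grind

/-- If `v` is in the kernel of a symmetric matrix, then the adjugate is proportional to `v vᵀ`. -/
theorem exists_adjSym_eq_smul_veronese {S : Sym3} {v : Fin 3 → ℂ} (hv : v ≠ 0)
    (h : S.1 *ᵥ v = 0) : ∃ c : ℂ, adjSym S = c • veronese v := by
  obtain ⟨i, hi⟩ := Function.ne_iff.1 hv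
  simp only [Pi.zero_apply] at hi
  refine ⟨S.1.adjugate i i / v i ^ 2, Subtype.ext ?_⟩
  ext j k
  have h1 := mul_adjugate_comm_of_mulVec_eq_zero h i j k
  have h2 := mul_adjugate_comm_of_mulVec_eq_zero h i k i
  have h3 : S.1.adjugate k i = S.1.adjugate i k := sym3_apply_comm (adjSym S) k i
  simp only [adjSym, Submodule.coe_smul, Matrix.smul_apply, veronese_apply, smul_eq_mul]
  field_simp
  rw [h3] at h2
  linear_combination v i * h1 + v j * h2

theorem trace_veronese_mul (v : Fin 3 → ℂ) (M : Matrix (Fin 3) (Fin 3) ℂ) :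
    ((veronese v).1 * M).trace = v ⬝ᵥ (M *ᵥ v) := by
  simp only [Matrix.trace_fin_three, Matrix.mul_apply, veronese_apply, dotProduct, Matrix.mulVec,
    Fin.sum_univ_three]
  ring

theorem minors_eq_of_adjugate_eq_zero {M : Matrix (Fin 3) (Fin 3) ℂ} (h : M.adjugate = 0)
    (i j k l : Fin 3) : M i j * M k l = M i l * M k j := by
  have h' : ∀ a b, M.adjugate a b = 0 := fun a b => by rw [h]; rfl
  have h00 := h' 0 0
  have h01 := h' 0 1
  have h02 := h' 0 2
  have h10 := h' 1 0
  have h11 := h' 1 1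
  have h12 := h' 1 2
  have h20 := h' 2 0
  have h21 := h' 2 1
  have h22 := h' 2 2
  simp [Matrix.adjugate_fin_three] at h00 h01 h02 h10 h11 h12 h20 h21 h22
  fin_cases i <;> fin_cases j <;> fin_cases k <;> fin_cases l <;> simp <;> grind

/-- The matrix `N v` with `N v *ᵥ x = P x *ᵥ v`. -/
def kernelMatrix (P : (Fin 3 → ℂ) →ₗ[ℂ] Sym3) : (Fin 3 → ℂ) →ₗ[ℂ] Matrix (Fin 3) (Fin 3) ℂ where
  toFun v := Matrix.of fun i k => ((P (Pi.single k 1)).1 *ᵥ v) i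
  map_add' v w := by
    ext i k
    simp [Matrix.mulVec_add]
  map_smul' c v := by
    ext i k
    simp [Matrix.mulVec_smul]

theorem kernelMatrix_mulVec (P : (Fin 3 → ℂ) →ₗ[ℂ] Sym3) (v x : Fin 3 → ℂ) :
    kernelMatrix P v *ᵥ x = (P x).1 *ᵥ v := by
  have hx : x = x 0 • Pi.single 0 1 + x 1 • Pi.single 1 1 + x 2 • Pi.single 2 1 := by
    ext i
    fin_cases i <;> simp
  have hP : P x = x 0 • P (Pi.single 0 1) + x 1 • P (Pi.single 1 1) + x 2 • P (Pi.single 2 1) := by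
    conv_lhs => rw [hx]
    simp only [map_add, map_smul]
  rw [hP]
  simp only [Submodule.coe_add, Submodule.coe_smul, Matrix.add_mulVec, Matrix.smul_mulVec]
  ext i
  simp only [kernelMatrix, LinearMap.coe_mk, AddHom.coe_mk, Matrix.mulVec, dotProduct,
    Fin.sum_univ_three, Matrix.of_apply, Pi.add_apply, Pi.smul_apply, smul_eq_mul]
  ring

section Smooth

variable {P : (Fin 3 → ℂ) →ₗ[ℂ] Sym3}

/-- Points of the Jacobian cubic are kernels of members of the net. -/
theorem exists_kernel (hsm : ∀ x ≠ 0, (P x).1.det = 0 → ∃ y, ((P x).1.adjugate * (P y).1).trace ≠ 0)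
    {v : Fin 3 → ℂ} (hv : v ≠ 0) (hd : (kernelMatrix P v).det = 0) :
    ∃ x ≠ 0, kernelMatrix P v *ᵥ x = 0 ∧ ∃ c : ℂ, c ≠ 0 ∧
      adjSym (P x) = c • veronese v ∧ ∃ y, v ⬝ᵥ ((P y).1 *ᵥ v) ≠ 0 := by
  obtain ⟨x, hx, hNx⟩ := Matrix.exists_mulVec_eq_zero_iff.2 hd
  have hPx := hNx
  rw [kernelMatrix_mulVec] at hPx
  obtain ⟨c, hc⟩ := exists_adjSym_eq_smul_veronese hv hPx
  obtain ⟨y, hy⟩ := hsm x hx (Matrix.exists_mulVec_eq_zero_iff.1 ⟨v, hv, hPx⟩)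
  have hadj : (P x).1.adjugate = c • (veronese v).1 := congrArg Subtype.val hc
  -- The nonzero derivative equals `c · vᵀ (P y) v`, so neither factor vanishes.
  rw [hadj, Matrix.smul_mul, Matrix.trace_smul, trace_veronese_mul, smul_eq_mul] at hy
  exact ⟨x, hx, hNx, c, left_ne_zero_of_mul hy, hc, y, right_ne_zero_of_mul hy⟩

/-- On a net with smooth discriminant, no matrix `kernelMatrix P v` has rank one. -/
theorem adjugate_kernelMatrix_ne_zero (hsm : ∀ x ≠ 0, (P x).1.det = 0 → ∃ y, ((P x).1.adjugate * (P y).1).trace ≠ 0)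
    {v : Fin 3 → ℂ} (hv : v ≠ 0) (hd : (kernelMatrix P v).det = 0) :
    (kernelMatrix P v).adjugate ≠ 0 := by
  intro hadj
  obtain ⟨x, hx, hNx, c, hc, hcx, y, hy⟩ := exists_kernel hsm hv hd
  set M := kernelMatrix P v with hM
  let ρ : (Fin 3 → ℂ) →ₗ[ℂ] ℂ := (dotProductBilin ℂ ℂ v).comp M.mulVecLin
  have hρ : ∀ z, ρ z = v ⬝ᵥ (M *ᵥ z) := fun z => rfl
  -- In rank at most one all vectors `M *ᵥ z` are proportional, so a single linear condition puts
  -- `v` in the kernel of `P z`: a whole pencil of members is singular at `v`.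
  have hker : ∀ z, ρ z = 0 → (P z).1 *ᵥ v = 0 := by
    intro z hz
    have hyz : ρ y • (M *ᵥ z) = ρ z • (M *ᵥ y) := by
      ext k
      have hl : (ρ y • (M *ᵥ z)) k = ∑ i, ∑ j, ∑ l, v i * y j * z l * (M i j * M k l) := by
        simp only [hρ, Pi.smul_apply, smul_eq_mul, dotProduct, Matrix.mulVec, Fin.sum_univ_three]
        ring
      have hr : (ρ z • (M *ᵥ y)) k = ∑ i, ∑ j, ∑ l, v i * y j * z l * (M i l * M k j) := by
        simp only [hρ, Pi.smul_apply, smul_eq_mul, dotProduct, Matrix.mulVec, Fin.sum_univ_three]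
        ring
      rw [hl, hr]
      simp only [minors_eq_of_adjugate_eq_zero hadj]
    rw [hz, zero_smul] at hyz
    rw [← kernelMatrix_mulVec]
    refine (smul_eq_zero.1 hyz).resolve_left ?_
    rwa [hρ, hM, kernelMatrix_mulVec]
  obtain ⟨i, hi⟩ := Function.ne_iff.1 hx
  obtain ⟨x', hx', hρx', hix'⟩ := exists_common_zero ρ (LinearMap.proj i)
  obtain ⟨k, hk⟩ := Function.ne_iff.1 hv
  simp only [Pi.zero_apply] at hi hk
  have hadjx : (P x).1.adjugate k k = c * (v k * v k) := by
    have := congrArg (fun S : Sym3 => S.1 k k) hcx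
    simpa [adjSym, veronese_apply] using this
  -- Adjugates in the pencil are multiples of `v vᵀ`, with coefficient quadratic in `s`. At a root
  -- the adjugate is zero, giving a singular point of the discriminant.
  obtain ⟨s, hs⟩ : ∃ s : ℂ, (P (x' + s • x)).1.adjugate k k = 0 := by
    have ha : (P x).1.adjugate k k ≠ 0 := by
      rw [hadjx]
      exact mul_ne_zero hc (mul_ne_zero hk hk)
    obtain ⟨s, hs⟩ := exists_quadratic_root
      (((P x').1 + (P x).1).adjugate k k - (P x').1.adjugate k k - (P x).1.adjugate k k)
      ((P x').1.adjugate k k) ha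
    refine ⟨s, ?_⟩
    rw [map_add, map_smul, Submodule.coe_add, Submodule.coe_smul, adjugate_add_smul]
    simp only [Matrix.add_apply, Matrix.smul_apply, Matrix.sub_apply, smul_eq_mul]
    linear_combination hs
  have hz : x' + s • x ≠ 0 := by
    intro h0
    have h1 := congrFun h0 i
    have h2 : x' i = 0 := hix'
    simp only [Pi.add_apply, Pi.smul_apply, smul_eq_mul, h2, zero_add, Pi.zero_apply] at h1
    rw [(mul_eq_zero.1 h1).resolve_right hi] at h0
    exact hx' (by simpa using h0)
  have hρz : ρ (x' + s • x) = 0 := by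
    rw [map_add, map_smul, hρx', hρ x, hNx]
    simp
  obtain ⟨c', hc'⟩ := exists_adjSym_eq_smul_veronese hv (hker _ hρz)
  have hadj' : (P (x' + s • x)).1.adjugate = c' • (veronese v).1 := congrArg Subtype.val hc'
  have hc'0 : c' = 0 := by
    rw [hadj', Matrix.smul_apply, veronese_apply, smul_eq_mul] at hs
    exact (mul_eq_zero.1 hs).resolve_right (mul_ne_zero hk hk)
  obtain ⟨y', hy'⟩ := hsm _ hz (Matrix.exists_mulVec_eq_zero_iff.1 ⟨v, hv, hker _ hρz⟩)
  exact hy' (by rw [hadj', hc'0]; simp)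

/-- The Jacobian cubic of a net with smooth discriminant is smooth. -/
theorem kernelMatrix_smooth (hsm : ∀ x ≠ 0, (P x).1.det = 0 → ∃ y, ((P x).1.adjugate * (P y).1).trace ≠ 0)
    (v : Fin 3 → ℂ) (hv : v ≠ 0) (hd : (kernelMatrix P v).det = 0) :
    ∃ w, ((kernelMatrix P v).adjugate * kernelMatrix P w).trace ≠ 0 := by
  by_contra! hsing
  obtain ⟨x, hx, hNx, c, hc, hcx, y, hy⟩ := exists_kernel hsm hv hd
  have hPx : (P x).1 *ᵥ v = 0 := by rwa [← kernelMatrix_mulVec]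
  apply adjugate_kernelMatrix_ne_zero hsm hv hd
  obtain ⟨i, hi⟩ := Function.ne_iff.1 hx
  simp only [Pi.zero_apply] at hi
  -- The columns of the adjugate are multiples of `x`, so it factors as `x rᵀ`.
  set r : Fin 3 → ℂ := fun k => (kernelMatrix P v).adjugate i k / x i with hr
  have hadj : ∀ j k, (kernelMatrix P v).adjugate j k = x j * r k := fun j k => by
    rw [hr]
    field_simp
    linear_combination mul_adjugate_comm_of_mulVec_eq_zero hNx i j k
  -- Singularity at `v` says `rᵀ N(w) x = rᵀ P(x) w = 0` for all `w`. As `P x` has rank two with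
  -- kernel vector `v`, this makes `r` a multiple of `v`.
  have hPr : (P x).1 *ᵥ r = 0 := by
    have h : ∀ w, r ⬝ᵥ ((P x).1 *ᵥ w) = 0 := fun w => by
      rw [← kernelMatrix_mulVec, ← hsing w]
      simp only [Matrix.trace_fin_three, Matrix.mul_apply, hadj, dotProduct, Matrix.mulVec,
        Fin.sum_univ_three]
      ring
    have h' : r ᵥ* (P x).1 = 0 := dotProduct_eq_zero _ fun w => by
      rw [← Matrix.dotProduct_mulVec]
      exact h w
    rwa [← Matrix.mulVec_transpose, show (P x).1ᵀ = (P x).1 from (P x).2] at h'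
  obtain ⟨k, hk⟩ := Function.ne_iff.1 hv
  simp only [Pi.zero_apply] at hk
  have hadjx : ∀ j l, (P x).1.adjugate j l = c * (v j * v l) := fun j l => by
    have := congrArg (fun S : Sym3 => S.1 j l) hcx
    simpa [adjSym, veronese_apply] using this
  have hrv : r = (r k / v k) • v := by
    ext j
    have h := mul_adjugate_comm_of_mulVec_eq_zero hPr j k k
    rw [hadjx, hadjx] at h
    simp only [Pi.smul_apply, smul_eq_mul]
    field_simp
    apply mul_left_cancel₀ (mul_ne_zero hc hk)
    linear_combination h
  -- Since `r` is a left null vector of `kernelMatrix P v`, a nonzero multiple `r` of `v` would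
  -- contradict `hy`.
  have hrN : r ⬝ᵥ (kernelMatrix P v *ᵥ y) = 0 := by
    have h : ((kernelMatrix P v).adjugate * kernelMatrix P v) *ᵥ y = 0 := by
      rw [Matrix.adjugate_mul, hd]
      simp
    rw [← Matrix.mulVec_mulVec] at h
    have hi' := congrFun h i
    simp only [Matrix.mulVec, dotProduct, hadj, Pi.zero_apply] at hi'
    apply mul_left_cancel₀ hi
    simp only [Matrix.mulVec, dotProduct, Finset.mul_sum] at hi' ⊢
    simpa [mul_assoc] using hi'
  rw [kernelMatrix_mulVec, hrv, smul_dotProduct, smul_eq_mul] at hrN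
  rw [(mul_eq_zero.1 hrN).resolve_right hy, zero_smul] at hrv
  ext j l
  rw [hadj, hrv]
  simp

end Smooth

/-! ### Nets with smooth discriminant -/

theorem map_conic (φ : Sym3 →ₗ[ℂ] ℂ) (a b c d e f : ℂ) : φ (conic a b c d e f) =
    a * φ (conic 1 0 0 0 0 0) + b * φ (conic 0 1 0 0 0 0) + c * φ (conic 0 0 1 0 0 0) +
    d * φ (conic 0 0 0 1 0 0) + e * φ (conic 0 0 0 0 1 0) + f * φ (conic 0 0 0 0 0 1) := by
  rw [conic_eq_sum]
  simp

theorem eq_zero_of_map_conic {φ : Sym3 →ₗ[ℂ] ℂ}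
    (h1 : φ (conic 1 0 0 0 0 0) = 0) (h2 : φ (conic 0 1 0 0 0 0) = 0)
    (h3 : φ (conic 0 0 1 0 0 0) = 0) (h4 : φ (conic 0 0 0 1 0 0) = 0)
    (h5 : φ (conic 0 0 0 0 1 0) = 0) (h6 : φ (conic 0 0 0 0 0 1) = 0) : φ = 0 := by
  ext S
  rw [sym3_eq_conic S, map_conic, h1, h2, h3, h4, h5, h6]
  simp

theorem eq_zero_of_map_veronese {φ : Sym3 →ₗ[ℂ] ℂ} (h : ∀ v, φ (veronese v) = 0) : φ = 0 := by
  have h' : ∀ x y z : ℂ, φ (conic (x ^ 2) (y ^ 2) (z ^ 2) (x * y) (x * z) (y * z)) = 0 :=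
    fun x y z => h ![x, y, z]
  have e1 := h' 1 0 0
  have e2 := h' 0 1 0
  have e3 := h' 0 0 1
  have e4 := h' 1 1 0
  have e5 := h' 1 0 1
  have e6 := h' 0 1 1
  rw [map_conic] at e1 e2 e3 e4 e5 e6
  simp at e1 e2 e3 e4 e5 e6
  simp only [e1, e2, e3, zero_add, add_zero] at e4 e5 e6
  exact eq_zero_of_map_conic e1 e2 e3 e4 e5 e6

/-- The adjugates of the members of a net with smooth discriminant span the symmetric matrices. -/
theorem adjugates_span_of_smooth {P : (Fin 3 → ℂ) →ₗ[ℂ] Sym3}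
    (hsm : ∀ x ≠ 0, (P x).1.det = 0 → ∃ y, ((P x).1.adjugate * (P y).1).trace ≠ 0)
    (φ : Sym3 →ₗ[ℂ] ℂ) (hφ : ∀ x, φ (adjSym (P x)) = 0) : φ = 0 := by
  -- A bilinear form, not symmetrized, since only its diagonal `φ (v vᵀ)` matters.
  let β : (Fin 3 → ℂ) →ₗ[ℂ] (Fin 3 → ℂ) →ₗ[ℂ] ℂ := LinearMap.mk₂ ℂ
    (fun v w => v 0 * w 0 * φ (conic 1 0 0 0 0 0) + v 1 * w 1 * φ (conic 0 1 0 0 0 0) +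
      v 2 * w 2 * φ (conic 0 0 1 0 0 0) + v 0 * w 1 * φ (conic 0 0 0 1 0 0) +
      v 0 * w 2 * φ (conic 0 0 0 0 1 0) + v 1 * w 2 * φ (conic 0 0 0 0 0 1))
    (fun _ _ _ => by simp only [Pi.add_apply]; ring)
    (fun _ _ _ => by simp only [Pi.smul_apply, smul_eq_mul]; ring)
    (fun _ _ _ => by simp only [Pi.add_apply]; ring)
    (fun _ _ _ => by simp only [Pi.smul_apply, smul_eq_mul]; ring)
  have hβ : ∀ v, β v v = φ (veronese v) := fun v => by
    rw [veronese, map_conic]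
    simp only [β, LinearMap.mk₂_apply]
    ring
  refine eq_zero_of_map_veronese fun v => ?_
  rw [← hβ]
  refine eq_zero_of_vanish_on_smooth_cubic (kernelMatrix P) (kernelMatrix_smooth hsm) β
    (fun w hw hd => ?_) v
  obtain ⟨x, -, -, c, hc, hcx, -⟩ := exists_kernel hsm hw hd
  have h := hφ x
  rw [hcx, map_smul, smul_eq_mul] at h
  rw [hβ]
  exact (mul_eq_zero.1 h).resolve_left hc


theorem projectivelyEquivalent_of_isTypeA {L : Submodule ℂ Sym3} (hA : IsTypeA L) :
    ProjectivelyEquivalent (reciprocalSurface L) veroneseSurface := by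
  obtain ⟨hL, hsm⟩ := hA
  obtain ⟨P, hP, hPL, hLP⟩ := hL.exists_parametrization
  refine projectivelyEquivalent_of_adjugates_span hL ?_ fun φ hφ =>
    adjugates_span_of_smooth (fun x hx hd => ?_) φ fun x => hφ _ (hPL x)
  -- If `det` vanished on all of the net, so would its directional derivatives, against smoothness.
  · by_contra! h
    obtain ⟨B, hB, hne⟩ := hsm (P (Pi.single 0 1)) (hPL _)
      (fun h0 => by
        have := congrFun (hP (h0.trans P.map_zero.symm)) 0
        simp at this) (h _ (hPL _))
    apply hne
    have h0 : (fun t : ℂ => ((P (Pi.single 0 1) + t • B : Sym3) :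
        Matrix (Fin 3) (Fin 3) ℂ).det) = fun _ => 0 :=
      funext fun t => h _ (L.add_mem (hPL _) (L.smul_mem t hB))
    rw [h0, deriv_const]
  · obtain ⟨B, hB, hne⟩ := hsm (P x) (hPL x)
      (fun h0 => hx (hP (h0.trans P.map_zero.symm))) hd
    obtain ⟨y, rfl⟩ := hLP B hB
    refine ⟨y, ?_⟩
    rw [← deriv_det_add_smul]
    exact hne

/-! ### Congruence invariance and the normal forms -/

/-- The congruence `S ↦ h S hᵀ` on symmetric matrices. -/
def congruence (h : Matrix (Fin 3) (Fin 3) ℂ) : Sym3 →ₗ[ℂ] Sym3 where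
  toFun S := ⟨h * S.1 * hᵀ, by
    change (h * S.1 * hᵀ)ᵀ = _
    rw [Matrix.transpose_mul, Matrix.transpose_mul, Matrix.transpose_transpose,
      show S.1ᵀ = S.1 from S.2, Matrix.mul_assoc]⟩
  map_add' S S' := by
    apply Subtype.ext
    simp [Matrix.mul_add, Matrix.add_mul]
  map_smul' c S := by
    apply Subtype.ext
    simp

/-- The criterion for the reciprocal surface, for a net congruent to a given one. -/
theorem projectivelyEquivalent_of_congruent {L₀ L : Submodule ℂ Sym3} (hL : IsNet L)
    (hcong : Congruent L₀ L) (hdet : ∃ A ∈ L₀, A.1.det ≠ 0)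
    (hspan : ∀ φ : Sym3 →ₗ[ℂ] ℂ, (∀ A ∈ L₀, φ (adjSym A) = 0) → φ = 0) :
    ProjectivelyEquivalent (reciprocalSurface L) veroneseSurface := by
  obtain ⟨g, hg⟩ := hcong
  have hg0 : (g : Matrix (Fin 3) (Fin 3) ℂ).det ≠ 0 := g.det_ne_zero
  have hmem : ∀ A ∈ L₀, congruence g.1ᵀ A ∈ L := fun A hA =>
    (hg _).2 ⟨A, hA, by simp [congruence]⟩
  refine projectivelyEquivalent_of_adjugates_span hL ?_ fun φ hφ => ?_
  · obtain ⟨A, hA, hd⟩ := hdet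
    refine ⟨_, hmem A hA, ?_⟩
    simp only [congruence, LinearMap.coe_mk, AddHom.coe_mk, Matrix.det_mul, Matrix.det_transpose,
      Matrix.transpose_transpose]
    exact mul_ne_zero (mul_ne_zero hg0 hd) hg0
  · have hadj : ∀ A, adjSym (congruence g.1ᵀ A) = congruence g.1.adjugate (adjSym A) := fun A => by
      apply Subtype.ext
      simp [adjSym, congruence, Matrix.adjugate_mul_distrib, Matrix.adjugate_transpose,
        Matrix.mul_assoc]
    have h0 : φ.comp (congruence g.1.adjugate) = 0 := hspan _ fun A hA => by
      rw [LinearMap.comp_apply, ← hadj]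
      exact hφ _ (hmem A hA)
    ext S
    -- Congruence by `adj g` is onto, because congruence by `g` inverts it up to the nonzero scalar
    -- `(det g)²`.
    have hS : congruence g.1.adjugate (congruence g.1 S) = g.1.det ^ 2 • S := by
      apply Subtype.ext
      change g.1.adjugate * (g.1 * S.1 * g.1ᵀ) * g.1.adjugateᵀ = g.1.det ^ 2 • S.1
      calc _ = (g.1.adjugate * g.1) * S.1 * (g.1.adjugate * g.1)ᵀ := by
            simp only [Matrix.transpose_mul, Matrix.mul_assoc]
        _ = _ := by
            rw [Matrix.adjugate_mul]
            simp [smul_smul, pow_two]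
    have h1 := LinearMap.congr_fun h0 (congruence g.1 S)
    rw [LinearMap.comp_apply, hS, map_smul, smul_eq_mul, LinearMap.zero_apply] at h1
    exact (mul_eq_zero.1 h1).resolve_left (pow_ne_zero 2 hg0)

theorem adjSym_conic (a b c d e f : ℂ) : adjSym (conic a b c d e f) =
    conic (b * c - f ^ 2) (a * c - e ^ 2) (a * b - d ^ 2) (e * f - c * d) (d * f - b * e)
      (d * e - a * f) := by
  apply Subtype.ext
  ext i j
  simp only [adjSym, conic, Matrix.adjugate_fin_three]
  fin_cases i <;> fin_cases j <;> simp <;> ring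

theorem det_conic (a b c d e f : ℂ) :
    (conic a b c d e f).1.det = a * b * c + 2 * d * e * f - a * f ^ 2 - b * e ^ 2 - c * d ^ 2 := by
  simp [conic, Matrix.det_fin_three]
  ring

theorem conic_mem_bStar (x y z : ℂ) : conic (-z) (x - 2 * z) 0 0 (x + z) y ∈ Submodule.span ℂ
    {conic 0 1 0 0 1 0, conic 0 0 0 0 0 1, conic (-1) (-2) 0 0 1 0} := by
  refine Submodule.mem_span_triple.2 ⟨x, y, z, Subtype.ext ?_⟩
  ext i j
  fin_cases i <;> fin_cases j <;> simp [conic] <;> ring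

theorem conic_mem_dStar (x y z : ℂ) : conic 0 0 z z x y ∈ Submodule.span ℂ
    {conic 0 0 0 0 1 0, conic 0 0 0 0 0 1, conic 0 0 1 1 0 0} := by
  refine Submodule.mem_span_triple.2 ⟨x, y, z, Subtype.ext ?_⟩
  ext i j
  fin_cases i <;> fin_cases j <;> simp [conic]

theorem conic_mem_eStar (x y z : ℂ) : conic 0 0 0 z x y ∈ Submodule.span ℂ
    {conic 0 0 0 0 1 0, conic 0 0 0 0 0 1, conic 0 0 0 1 0 0} := by
  refine Submodule.mem_span_triple.2 ⟨x, y, z, Subtype.ext ?_⟩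
  ext i j
  fin_cases i <;> fin_cases j <;> simp [conic]

/-- The adjugate of the general member has entries `-y²`, `-(x+z)²`, `2z²-xz`, `(x+z)y`,
`(2z-x)(x+z)`, `yz`. These quadrics are linearly independent, and six sample members already detect
this. -/
theorem projectivelyEquivalent_of_isTypeBStar {L : Submodule ℂ Sym3} (hL : IsNet L)
    (hB : IsTypeBStar L) : ProjectivelyEquivalent (reciprocalSurface L) veroneseSurface := by
  refine projectivelyEquivalent_of_congruent hL hB
    ⟨_, conic_mem_bStar 1 0 0, by rw [det_conic]; norm_num⟩ fun φ hφ => ?_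
  have h := fun x y z => hφ _ (conic_mem_bStar x y z)
  simp only [adjSym_conic] at h
  have e1 := h 1 0 0
  have e2 := h 0 1 0
  have e3 := h 0 0 1
  have e4 := h 1 0 1
  have e5 := h 1 1 0
  have e6 := h 0 1 1
  rw [map_conic] at e1 e2 e3 e4 e5 e6
  apply eq_zero_of_map_conic <;> grind

/-- Here the entries of the adjugate are `-y²`, `-x²`, `-z²`, `xy-z²`, `yz`, `xz`, again
independent. -/
theorem projectivelyEquivalent_of_isTypeDStar {L : Submodule ℂ Sym3} (hL : IsNet L)
    (hD : IsTypeDStar L) : ProjectivelyEquivalent (reciprocalSurface L) veroneseSurface := by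
  refine projectivelyEquivalent_of_congruent hL hD
    ⟨_, conic_mem_dStar 0 1 1, by rw [det_conic]; norm_num⟩ fun φ hφ => ?_
  have h := fun x y z => hφ _ (conic_mem_dStar x y z)
  simp only [adjSym_conic] at h
  have e1 := h 1 0 0
  have e2 := h 0 1 0
  have e3 := h 0 0 1
  have e4 := h 1 0 1
  have e5 := h 1 1 0
  have e6 := h 0 1 1
  rw [map_conic] at e1 e2 e3 e4 e5 e6
  apply eq_zero_of_map_conic <;> grind

/-- Here the entries are, up to sign, the six monomials of degree two. -/
theorem projectivelyEquivalent_of_isTypeEStar {L : Submodule ℂ Sym3} (hL : IsNet L)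
    (hE : IsTypeEStar L) : ProjectivelyEquivalent (reciprocalSurface L) veroneseSurface := by
  refine projectivelyEquivalent_of_congruent hL hE
    ⟨_, conic_mem_eStar 1 1 1, by rw [det_conic]; norm_num⟩ fun φ hφ => ?_
  have h := fun x y z => hφ _ (conic_mem_eStar x y z)
  simp only [adjSym_conic] at h
  have e1 := h 1 0 0
  have e2 := h 0 1 0
  have e3 := h 0 0 1
  have e4 := h 1 0 1
  have e5 := h 1 1 0
  have e6 := h 0 1 1
  rw [map_conic] at e1 e2 e3 e4 e5 e6
  apply eq_zero_of_map_conic <;> grind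

end NetsOfConics

theorem theorem3p2 (L : Submodule ℂ NetsOfConics.Sym3) (hL : NetsOfConics.IsNet L)
    (hType : NetsOfConics.IsTypeA L ∨ NetsOfConics.IsTypeBStar L ∨
      NetsOfConics.IsTypeDStar L ∨ NetsOfConics.IsTypeEStar L) :
    NetsOfConics.ProjectivelyEquivalent (NetsOfConics.reciprocalSurface L)
      NetsOfConics.veroneseSurface := by
  rcases hType with h | h | h | h
  · exact NetsOfConics.projectivelyEquivalent_of_isTypeA h
  · exact NetsOfConics.projectivelyEquivalent_of_isTypeBStar hL h
  · exact NetsOfConics.projectivelyEquivalent_of_isTypeDStar hL h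
  · exact NetsOfConics.projectivelyEquivalent_of_isTypeEStar hL h
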